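/- Let $p$ be a prime. For a profinite group $G$, write $H^2(G)=H^2(G,\mathbb{Z}/p)$ for the second profinite (continuous) cohomology group with trivial action on $\mathbb{Z}/p$. Fix a nonempty set $\Omega$ of central extensions of profinite groups $$\omega:\quad 0\to\mathbb{Z}/p\to\mathbb{U}_\omega\xrightarrow{\lambda_\omega}\bar{\mathbb{U}}_\omega\to1$$ such that for every $\omega\in\Omega$: (I) there are finitely many continuous homomorphisms $\gamma_1,\dots,\gamma_n\colon\bar{\mathbb{U}}_\omega\to\mathbb{U}_\omega$ with $\bigcap_{i=1}^n\mathrm{Ker}(\gamma_i)=\{1\}$; (II) $\mathbb{Z}/p$ embeds in $\bar{\mathbb{U}}_\omega$. Let $\alpha_\omega\in H^2(\bar{\mathbb{U}}_\omega)$ be the classifying element of $\omega$. For a profinite group $G$ let $T(G)$ (resp., $\bar T(G)$) be the intersection of the kernels of all continuous homomorphisms $G\to\mathbb{U}_\omega$ (resp., $G\to\bar{\mathbb{U}}_\omega$), where $\omega$ ranges over $\Omega$. For a closed normal subgroup $N$ of $G$ contained in $\bar T(G)$, with projection $\pi\colon G\to G/N$, a continuous homomorphism $\bar\rho\colon G/N\to\bar{\mathbb{U}}_\omega$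 is called $\pi$-liftable if there is a continuous homomorphism $\rho\colon G\to\mathbb{U}_\omega$ with $\lambda_\omega\circ\rho=\bar\rho\circ\pi$. Let $H^2(G/N)_\pi$ be the subgroup of $H^2(G/N)$ generated by all pullbacks $\bar\rho^*(\alpha_\omega)$, where $\omega\in\Omega$ and $\bar\rho\colon G/N\to\bar{\mathbb{U}}_\omega$ is $\pi$-liftable. Let $G$ be a profinite group, let $N_1\le N_2$ be closed normal subgroups of $G$ contained in $\bar T(G)$, and let $\pi_i\colon G\to G/N_i$, $i=1,2$, be the natural projections. Inflation $H^2(G/N_2)\to H^2(G/N_1)$ maps $H^2(G/N_2)_{\pi_2}$ into $H^2(G/N_1)_{\pi_1}$, and the following conditions are equivalent: (a) $\inf\colon H^2(G/N_2)_{\pi_2}\to H^2(G/N_1)_{\pi_1}$ is an isomorphism; (b) $\inf\colon H^2(G/N_2)_{\pi_2}\to H^2(G/N_1)_{\pi_1}$ is injective; (c) $N_1T(G)=N_2T(G)$. -/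

import Mathlib

/-- A central extension `0 → ℤ/m → U → Ū → 1` of profinite groups: a short exact sequence of
groups in which the projection `U → Ū` is continuous and `ℤ/m` (written multiplicatively) is
mapped into the centre of `U`. Continuity of the inclusion is automatic, as `ℤ/m` is discrete. -/
structure ProfiniteCentralExtension.{u} (m : ℕ) where
  /-- the middle group -/
  U : ProfiniteGrp.{u}
  /-- the quotient group -/
  Ubar : ProfiniteGrp.{u}
  /-- the underlying short exact sequence of groups -/
  ext : GroupExtension (Multiplicative (ZMod m)) U Ubar
  continuous_rightHom : Continuous ext.rightHom
  central : ext.inl.range ≤ Subgroup.center U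

namespace ProfiniteCohomology

section Cohomology

variable (m : ℕ) (G : Type*) [Group G] [TopologicalSpace G] [IsTopologicalGroup G]

/-- The coboundary of a continuous inhomogeneous `1`-cochain with coefficients in the trivial
module `ℤ/m`: `(δ b)(g, h) = b h - b (g h) + b g`. -/
def d1 : C(G, ZMod m) →+ C(G × G, ZMod m) where
  toFun b := ⟨fun x => b x.2 - b (x.1 * x.2) + b x.1, by fun_prop⟩
  map_zero' := by ext; simp
  map_add' b c := by
    ext x
    simp only [ContinuousMap.coe_mk, ContinuousMap.add_apply]
    abel

/-- The coboundary of a continuous inhomogeneous `2`-cochain with coefficients in the trivial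
module `ℤ/m`: `(δ f)(g, h, k) = f (h, k) - f (g h, k) + f (g, h k) - f (g, h)`. -/
def d2 : C(G × G, ZMod m) →+ C(G × G × G, ZMod m) where
  toFun f := ⟨fun x => f (x.2.1, x.2.2) - f (x.1 * x.2.1, x.2.2) + f (x.1, x.2.1 * x.2.2)
    - f (x.1, x.2.1), by fun_prop⟩
  map_zero' := by ext; simp
  map_add' f g := by
    ext x
    simp only [ContinuousMap.coe_mk, ContinuousMap.add_apply]
    abel

/-- The second continuous cohomology group `H²(G) = H²(G, ℤ/m)` with trivial action on the
discrete module `ℤ/m`: continuous inhomogeneous `2`-cocycles modulo coboundaries of continuous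
`1`-cochains. -/
abbrev H2 : Type _ := (d2 m G).ker ⧸ ((d1 m G).range.addSubgroupOf (d2 m G).ker)

variable {G} {H K : Type*} [Group H] [TopologicalSpace H] [IsTopologicalGroup H]
  [Group K] [TopologicalSpace K] [IsTopologicalGroup K]

/-- Pullback of continuous `2`-cocycles along a continuous homomorphism. -/
def cocyclePullback (φ : G →ₜ* H) : (d2 m H).ker →+ (d2 m G).ker where
  toFun f := ⟨⟨fun x => f.1 (φ x.1, φ x.2), by fun_prop⟩, by
    rw [AddMonoidHom.mem_ker]
    ext x
    have h := DFunLike.congr_fun ((AddMonoidHom.mem_ker).1 f.2) (φ x.1, φ x.2.1, φ x.2.2)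
    simpa [d2] using h⟩
  map_zero' := rfl
  map_add' _ _ := rfl

/-- The homomorphism `φ* : H²(H) → H²(G)` induced by a continuous homomorphism `φ : G → H`. -/
def pullback (φ : G →ₜ* H) : H2 m H →+ H2 m G :=
  QuotientAddGroup.map _ _ (cocyclePullback m φ) (by
    rintro ⟨f, hf⟩ hb
    obtain ⟨b, hb⟩ := AddSubgroup.mem_addSubgroupOf.1 hb
    change d1 m H b = f at hb
    subst hb
    refine AddSubgroup.mem_comap.2 (AddSubgroup.mem_addSubgroupOf.2 ?_)
    refine ⟨(⟨fun x => b (φ x), by fun_prop⟩ : C(G, ZMod m)), ?_⟩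
    ext x
    change b (φ x.2) - b (φ (x.1 * x.2)) + b (φ x.1) =
      b (φ x.2) - b (φ x.1 * φ x.2) + b (φ x.1)
    rw [map_mul])

theorem pullback_comp (φ : G →ₜ* H) (ψ : H →ₜ* K) (x : H2 m K) :
    pullback m (ψ.comp φ) x = pullback m φ (pullback m ψ x) := by
  induction x using QuotientAddGroup.induction_on with
  | H f => rfl

end Cohomology

end ProfiniteCohomology

namespace ProfiniteCentralExtension

open ProfiniteCohomology

variable {m : ℕ}

/-- The projection `λ : U → Ū` as a continuous homomorphism. -/
def proj (ω : ProfiniteCentralExtension m) : ω.U →ₜ* ω.Ubar :=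
  ⟨ω.ext.rightHom, ω.continuous_rightHom⟩

theorem proj_surjective (ω : ProfiniteCentralExtension m) : Function.Surjective ω.proj :=
  ω.ext.rightHom_surjective

theorem proj_eq_one_iff (ω : ProfiniteCentralExtension m) (u : ω.U) :
    ω.proj u = 1 ↔ ∃ z, ω.ext.inl z = u := by
  have h := ω.ext.range_inl_eq_ker_rightHom
  rw [← MonoidHom.mem_range, h, MonoidHom.mem_ker]
  rfl

/-- Since `ℤ/m` is finite, the projection `U → Ū` has a continuous set-theoretic section. -/
theorem exists_section [NeZero m] (ω : ProfiniteCentralExtension m) :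
    ∃ s : C(ω.Ubar, ω.U), ∀ x, ω.proj (s x) = x := by
  -- an open normal subgroup `V` that meets the kernel trivially
  have hfin : (Set.range ω.ext.inl).Finite := Set.finite_range _
  have hopen : IsOpen (Set.range ω.ext.inl \ {1})ᶜ :=
    (hfin.subset Set.sdiff_subset).isClosed.isOpen_compl
  obtain ⟨V, hV⟩ := ProfiniteGrp.exist_openNormalSubgroup_sub_open_nhds_of_one
    (G := ω.U) hopen (by simp)
  have hinj : ∀ v ∈ V.toSubgroup, ω.proj v = 1 → v = 1 := by
    intro v hv h
    by_contra hne
    exact hV hv ⟨(ω.proj_eq_one_iff v).1 h, hne⟩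
  -- the section is the inverse of the projection restricted to a union `S` of cosets of `V`
  let P : Subgroup ω.U := (V.toSubgroup.map ω.proj.toMonoidHom).comap ω.proj.toMonoidHom
  have hVP : V.toSubgroup ≤ P := Subgroup.le_comap_map _ _
  have hP : IsOpen (P : Set ω.U) := Subgroup.isOpen_mono hVP V.isOpen
  have : DiscreteTopology (ω.U ⧸ P) := QuotientGroup.discreteTopology hP
  let r : ω.U → ω.U := fun u => Quotient.out (QuotientGroup.mk u : ω.U ⧸ P)
  have hr : Continuous r :=
    (continuous_of_discreteTopology (f := fun c : ω.U ⧸ P => Quotient.out c)).comp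
      continuous_quotient_mk'
  have hrP : ∀ u, (r u)⁻¹ * u ∈ P := fun u => QuotientGroup.eq.1 (QuotientGroup.out_eq' _)
  have hreq : ∀ u u', u⁻¹ * u' ∈ P → r u = r u' := fun u u' h =>
    congrArg Quotient.out (QuotientGroup.eq.2 h)
  let S : Set ω.U := {u | (r u)⁻¹ * u ∈ V.toSubgroup}
  have hS : IsClosed S :=
    (Subgroup.isClosed_of_isOpen _ V.isOpen).preimage (hr.inv.mul continuous_id)
  have : CompactSpace S := isCompact_iff_compactSpace.1 hS.isCompact
  let f : S → ω.Ubar := fun u => ω.proj u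
  have hf : Continuous f := ω.proj.continuous_toFun.comp continuous_subtype_val
  have hbij : Function.Bijective f := by
    constructor
    · rintro ⟨u, hu⟩ ⟨u', hu'⟩ h
      have h1 : ω.proj (u⁻¹ * u') = 1 := by
        rw [map_mul, map_inv]
        exact inv_mul_eq_one.2 h
      have h2 : r u = r u' := hreq _ _ ⟨1, one_mem _, by
        rw [map_one]
        exact h1.symm⟩
      have h3 : u⁻¹ * u' ∈ V.toSubgroup := by
        have h4 := V.toSubgroup.mul_mem (V.toSubgroup.inv_mem hu) hu'
        rw [← h2] at h4
        simpa using h4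
      exact Subtype.ext (inv_mul_eq_one.1 (hinj _ h3 h1))
    · intro x
      obtain ⟨u, rfl⟩ := ω.proj_surjective x
      obtain ⟨v, hv, hvu⟩ := hrP u
      have hvu' : ω.proj v = ω.proj ((r u)⁻¹ * u) := hvu
      have hpr : ω.proj (r u * v) = ω.proj u := by
        rw [map_mul, hvu', ← map_mul, mul_inv_cancel_left]
      have h5 : r (r u * v) = r u := by
        refine hreq _ _ ⟨1, one_mem _, ?_⟩
        rw [map_one]
        refine Eq.symm (?_ : ω.proj ((r u * v)⁻¹ * u) = 1)
        rw [map_mul, map_inv, hpr, inv_mul_cancel]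
      refine ⟨⟨r u * v, ?_⟩, hpr⟩
      change (r (r u * v))⁻¹ * (r u * v) ∈ V.toSubgroup
      rw [h5, inv_mul_cancel_left]
      exact hv
  let e := hf.homeoOfEquivCompactToT2 (f := Equiv.ofBijective f hbij)
  exact ⟨⟨fun x => (e.symm x : ω.U), continuous_subtype_val.comp e.symm.continuous⟩,
    fun x => e.apply_symm_apply x⟩

/-- A continuous set-theoretic section of `U → Ū`. -/
noncomputable def sec [NeZero m] (ω : ProfiniteCentralExtension m) : C(ω.Ubar, ω.U) :=
  ω.exists_section.choose

theorem proj_sec [NeZero m] (ω : ProfiniteCentralExtension m) (x : ω.Ubar) :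
    ω.proj (ω.sec x) = x :=
  ω.exists_section.choose_spec x

theorem exists_factor [NeZero m] (ω : ProfiniteCentralExtension m) (x y : ω.Ubar) :
    ∃ z : Multiplicative (ZMod m), ω.ext.inl z = ω.sec x * ω.sec y * (ω.sec (x * y))⁻¹ := by
  rw [← proj_eq_one_iff]
  simp [proj_sec]

/-- The factor set of the section `s`: the element `f (x, y)` of `ℤ/m` whose image in `U` is
`s x * s y * (s (x * y))⁻¹`. -/
noncomputable def factor [NeZero m] (ω : ProfiniteCentralExtension m) (x y : ω.Ubar) : ZMod m :=
  (ω.exists_factor x y).choose.toAdd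

theorem inl_factor [NeZero m] (ω : ProfiniteCentralExtension m) (x y : ω.Ubar) :
    ω.ext.inl (.ofAdd (ω.factor x y)) = ω.sec x * ω.sec y * (ω.sec (x * y))⁻¹ :=
  (ω.exists_factor x y).choose_spec

theorem continuous_factor [NeZero m] (ω : ProfiniteCentralExtension m) :
    Continuous fun x : ω.Ubar × ω.Ubar => ω.factor x.1 x.2 := by
  have hc : Topology.IsClosedEmbedding fun z : ZMod m => ω.ext.inl (.ofAdd z) :=
    (continuous_of_discreteTopology).isClosedEmbedding
      (ω.ext.inl_injective.comp Multiplicative.ofAdd.injective)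
  rw [hc.isInducing.continuous_iff]
  have : ((fun z : ZMod m => ω.ext.inl (.ofAdd z)) ∘ fun x : ω.Ubar × ω.Ubar =>
      ω.factor x.1 x.2) = fun x => ω.sec x.1 * ω.sec x.2 * (ω.sec (x.1 * x.2))⁻¹ :=
    funext fun x => ω.inl_factor x.1 x.2
  rw [this]
  fun_prop

theorem factor_cocycle [NeZero m] (ω : ProfiniteCentralExtension m) (x y z : ω.Ubar) :
    ω.factor y z + ω.factor x (y * z) = ω.factor (x * y) z + ω.factor x y := by
  apply Multiplicative.ofAdd.injective
  apply ω.ext.inl_injective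
  have hc := Subgroup.mem_center_iff.1 (ω.central ⟨.ofAdd (ω.factor y z), rfl⟩) (ω.sec x)
  rw [add_comm (ω.factor (x * y) z), ofAdd_add, ofAdd_add, map_mul, map_mul]
  calc ω.ext.inl (.ofAdd (ω.factor y z)) * ω.ext.inl (.ofAdd (ω.factor x (y * z)))
      = ω.sec x * ω.ext.inl (.ofAdd (ω.factor y z)) * ω.sec (y * z)
          * (ω.sec (x * (y * z)))⁻¹ := by
        rw [hc, ω.inl_factor x (y * z)]
        group
    _ = ω.ext.inl (.ofAdd (ω.factor x y)) * ω.ext.inl (.ofAdd (ω.factor (x * y) z)) := by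
        rw [ω.inl_factor y z, ω.inl_factor x y, ω.inl_factor (x * y) z, mul_assoc x y z]
        group

/-- The factor set as a continuous `2`-cocycle. -/
noncomputable def cocycle [NeZero m] (ω : ProfiniteCentralExtension m) : (d2 m ω.Ubar).ker :=
  ⟨⟨fun x => ω.factor x.1 x.2, ω.continuous_factor⟩, by
    rw [AddMonoidHom.mem_ker]
    ext x
    have h := ω.factor_cocycle x.1 x.2.1 x.2.2
    simp only [d2, AddMonoidHom.coe_mk, ZeroHom.coe_mk, ContinuousMap.coe_mk,
      ContinuousMap.zero_apply]
    linear_combination h⟩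

/-- The classifying element `α_ω ∈ H²(Ū)` of the extension: the class of the factor set of a
continuous section (this class does not depend on the section). -/
noncomputable def classifying [NeZero m] (ω : ProfiniteCentralExtension m) : H2 m ω.Ubar :=
  QuotientAddGroup.mk ω.cocycle

/-- Finitely many continuous homomorphisms `Ū → U` have trivial common kernel. -/
def SeparatedByHoms (ω : ProfiniteCentralExtension m) : Prop :=
  ∃ (n : ℕ) (γ : Fin n → (ω.Ubar →ₜ* ω.U)), ⨅ i, (γ i).toMonoidHom.ker = ⊥

/-- The kernel `ℤ/m` embeds in the quotient group `Ū`. -/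
def KernelEmbeds (ω : ProfiniteCentralExtension m) : Prop :=
  ∃ j : Multiplicative (ZMod m) →* ω.Ubar, Function.Injective j

end ProfiniteCentralExtension

namespace ProfiniteCohomology

section Liftable

/-- The subgroup `T^U(G)`: the intersection of the kernels of all continuous homomorphisms
`G → U`. -/
def homKernel (U G : Type*) [Group U] [TopologicalSpace U] [Group G] [TopologicalSpace G] :
    Subgroup G :=
  ⨅ ρ : G →ₜ* U, ρ.toMonoidHom.ker

variable {m : ℕ} (Ω : Set (ProfiniteCentralExtension m))
  (G : Type*) [Group G] [TopologicalSpace G]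

/-- `T(G)`: the intersection of the subgroups `T^U(G)`, where `U` runs over the middle groups of
the extensions in `Ω`. -/
def T : Subgroup G := ⨅ ω ∈ Ω, homKernel ω.U G

/-- `T̄(G)`: the intersection of the subgroups `T^Ū(G)`, where `Ū` runs over the quotient groups of
the extensions in `Ω`. -/
def Tbar : Subgroup G := ⨅ ω ∈ Ω, homKernel ω.Ubar G

variable {G}

/-- A continuous homomorphism `ρ' : G/N → Ū` is liftable (with respect to the projection
`G → G/N`) if there is a continuous homomorphism `ρ : G → U` such that `λ ∘ ρ` is the composition
of the projection with `ρ'`. -/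
def IsLiftable (ω : ProfiniteCentralExtension m) (N : Subgroup G) [N.Normal]
    (ρ' : (G ⧸ N) →ₜ* ω.Ubar) : Prop :=
  ∃ ρ : G →ₜ* ω.U, ∀ g : G, ω.proj (ρ g) = ρ' (QuotientGroup.mk g)

variable [IsTopologicalGroup G]

/-- The liftable part of `H²(G/N)`: the subgroup generated by the pullbacks of the classifying
elements of the extensions in `Ω` along liftable homomorphisms. -/
def liftablePart [NeZero m] (N : Subgroup G) [N.Normal] : AddSubgroup (H2 m (G ⧸ N)) :=
  AddSubgroup.closure {x | ∃ ω ∈ Ω, ∃ ρ' : (G ⧸ N) →ₜ* ω.Ubar,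
    IsLiftable ω N ρ' ∧ x = pullback m ρ' ω.classifying}

/-- The natural projection `G/N₁ → G/N₂` for `N₁ ≤ N₂`. -/
def quotientProj {N₁ N₂ : Subgroup G} [N₁.Normal] [N₂.Normal] (h : N₁ ≤ N₂) :
    (G ⧸ N₁) →ₜ* (G ⧸ N₂) where
  toMonoidHom := QuotientGroup.map N₁ N₂ (MonoidHom.id G) h
  continuous_toFun := continuous_quot_lift _ continuous_quotient_mk'

/-- The inflation homomorphism `H²(G/N₂) → H²(G/N₁)` for `N₁ ≤ N₂`. -/
def inflation (m : ℕ) {N₁ N₂ : Subgroup G} [N₁.Normal] [N₂.Normal] (h : N₁ ≤ N₂) :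
    H2 m (G ⧸ N₂) →+ H2 m (G ⧸ N₁) :=
  pullback m (quotientProj h)

theorem inflation_mem_liftablePart [NeZero m] {N₁ N₂ : Subgroup G} [N₁.Normal] [N₂.Normal]
    (h : N₁ ≤ N₂) (x : H2 m (G ⧸ N₂)) (hx : x ∈ liftablePart Ω N₂) :
    inflation m h x ∈ liftablePart Ω N₁ := by
  change x ∈ (liftablePart Ω N₁).comap (inflation m h)
  refine (AddSubgroup.closure_le _).2 ?_ hx
  rintro _ ⟨ω, hω, ρ', ⟨ρ, hρ⟩, rfl⟩
  exact AddSubgroup.subset_closure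
    ⟨ω, hω, ρ'.comp (quotientProj h), ⟨ρ, hρ⟩, (pullback_comp m _ _ _).symm⟩

/-- The inflation homomorphism between the liftable parts of `H²(G/N₂)` and `H²(G/N₁)`. -/
def liftableInflation [NeZero m] {N₁ N₂ : Subgroup G} [N₁.Normal] [N₂.Normal] (h : N₁ ≤ N₂) :
    liftablePart Ω N₂ →+ liftablePart Ω N₁ :=
  ((inflation m h).comp (liftablePart Ω N₂).subtype).codRestrict (liftablePart Ω N₁)
    fun x => inflation_mem_liftablePart Ω h x.1 x.2

end Liftable

end ProfiniteCohomology

/-! For `N ≤ Tbar Ω G`, each `ρ : G → U` maps `N` into the central `ℤ/p`, and the pullback of the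
classifying element along the induced map `G/N → Ū` is, up to sign, the transgression of `ρ|N`.
Condition (II) makes every `G → ℤ/p` kill `N`, so transgression is injective. Hence the liftable
part of `H²(G/N)` is a copy of the group `Θ(N)` of homomorphisms `N → ℤ/p` generated by the `ρ|N`,
whose common kernel is `N ∩ T(G)`.

Inflation becomes restriction `Θ(N₂) → Θ(N₁)`. It is always onto, and it is injective if `N₂ ≤
N₁T(G)` (`liftableInflation_injective_of_le_sup`). Conversely, if it is injective, linear algebra
over `𝔽_p` matches each `y ∈ N₂` with some `n ∈ N₁` on finitely many members of `Θ(N₂)`; compactness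
of `N₁` gives one `n` for all of them, so `n⁻¹y ∈ T(G)`. -/

namespace ProfiniteCohomology

/-! ### Transgression as a relation between classes and cochains. -/

section Transgression

variable {m : ℕ} {G : Type*} [Group G] [TopologicalSpace G] [IsTopologicalGroup G]

/-- The pairs of a class `x ∈ H²(G/N)` and a continuous cochain `b` on `G` whose coboundary is the
inflation to `G` of a cocycle representing `x`. The restriction of `b - b 1` to `N` is then a
homomorphism whose transgression is `x`. -/
def transgressionRel (m : ℕ) (N : Subgroup G) [N.Normal] :
    AddSubgroup (H2 m (G ⧸ N) × C(G, ZMod m)) where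
  carrier := {q | ∃ f : (d2 m (G ⧸ N)).ker, QuotientAddGroup.mk f = q.1 ∧
    ∀ g h : G, q.2 h - q.2 (g * h) + q.2 g = f.1 (QuotientGroup.mk g, QuotientGroup.mk h)}
  zero_mem' := ⟨0, rfl, by simp⟩
  add_mem' := by
    rintro ⟨x, b⟩ ⟨y, c⟩ ⟨f, rfl, hf⟩ ⟨f', rfl, hf'⟩
    refine ⟨f + f', rfl, fun g h => ?_⟩
    have h1 := hf g h
    have h2 := hf' g h
    simp only [Prod.mk_add_mk, ContinuousMap.add_apply, AddSubgroup.coe_add] at h1 h2 ⊢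
    linear_combination h1 + h2
  neg_mem' := by
    rintro ⟨x, b⟩ ⟨f, rfl, hf⟩
    refine ⟨-f, rfl, fun g h => ?_⟩
    have h1 := hf g h
    simp only [Prod.neg_mk, ContinuousMap.neg_apply, AddSubgroup.coe_neg] at h1 ⊢
    linear_combination -h1

variable {N : Subgroup G} [N.Normal]

/-- Compare the coboundary at `(g, n)` and `(g, 1)`: both pairs have the same image in `G/N`.
Subtracting `q.2 1` is needed because cochains are not normalised. -/
theorem transgressionRel_apply_mul {q : H2 m (G ⧸ N) × C(G, ZMod m)}
    (hq : q ∈ transgressionRel m N) (g : G) {n : G} (hn : n ∈ N) :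
    q.2 (g * n) - q.2 1 = (q.2 g - q.2 1) + (q.2 n - q.2 1) := by
  obtain ⟨f, -, hf⟩ := hq
  have h1 := hf g n
  have h2 := hf g 1
  rw [(QuotientGroup.eq_one_iff n).2 hn] at h1
  rw [QuotientGroup.mk_one, ← h1, mul_one] at h2
  linear_combination h2

theorem transgressionRel_apply_inv {q : H2 m (G ⧸ N) × C(G, ZMod m)}
    (hq : q ∈ transgressionRel m N) {n : G} (hn : n ∈ N) :
    q.2 n⁻¹ - q.2 1 = -(q.2 n - q.2 1) := by
  have h := transgressionRel_apply_mul hq n⁻¹ hn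
  rw [inv_mul_cancel] at h
  linear_combination -h

/-- The transgression of the trivial homomorphism is trivial. -/
theorem eq_zero_of_mem_transgressionRel {q : H2 m (G ⧸ N) × C(G, ZMod m)}
    (hq : q ∈ transgressionRel m N) (hb : ∀ n ∈ N, q.2 n = q.2 1) : q.1 = 0 := by
  -- The cochain is constant on cosets of `N`, so it descends to `G/N` and bounds `f` there.
  have hinv : ∀ g h : G, QuotientGroup.leftRel N g h → q.2 g = q.2 h := by
    intro g h hgh
    have hn := QuotientGroup.leftRel_apply.1 hgh
    have h1 := transgressionRel_apply_mul hq g hn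
    rw [mul_inv_cancel_left, hb _ hn] at h1
    linear_combination -h1
  obtain ⟨f, hf, hd⟩ := hq
  rw [← hf]
  refine (QuotientAddGroup.eq_zero_iff f).2 (AddSubgroup.mem_addSubgroupOf.2 ?_)
  refine ⟨⟨fun c => Quotient.lift q.2 hinv c, q.2.continuous.quotient_lift hinv⟩, ?_⟩
  ext ⟨x, y⟩
  induction x using QuotientGroup.induction_on with
  | H g =>
    induction y using QuotientGroup.induction_on with
    | H h => exact hd g h

/-- The transgression is injective if all continuous homomorphisms `G → ℤ/m` vanish on `N`. -/
theorem eq_of_zero_mem_transgressionRel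
    (hN : ∀ χ : G →ₜ* Multiplicative (ZMod m), ∀ n ∈ N, χ n = 1) {b : C(G, ZMod m)}
    (hb : ((0 : H2 m (G ⧸ N)), b) ∈ transgressionRel m N) {n : G} (hn : n ∈ N) : b n = b 1 := by
  obtain ⟨f, hf, hd⟩ := hb
  obtain ⟨a, ha⟩ := AddSubgroup.mem_addSubgroupOf.1 ((QuotientAddGroup.eq_zero_iff f).1 hf)
  have ha' : ∀ g h : G, a (QuotientGroup.mk h) - a (QuotientGroup.mk (g * h))
      + a (QuotientGroup.mk g) = f.1 (QuotientGroup.mk g, QuotientGroup.mk h) :=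
    fun g h => DFunLike.congr_fun ha (QuotientGroup.mk g, QuotientGroup.mk h)
  -- Both `b` and the inflation of `a` bound the inflated cocycle, so their difference is a
  -- homomorphism on `G`.
  have hmul : ∀ g h : G, b (g * h) - a (QuotientGroup.mk (g * h)) =
      (b g - a (QuotientGroup.mk g)) + (b h - a (QuotientGroup.mk h)) := by
    intro g h
    have h1 := ha' g h
    have h2 := hd g h
    simp only at h2
    linear_combination h1 - h2
  have hone : b 1 - a (QuotientGroup.mk 1) = 0 := by
    have h1 := hmul 1 1
    rw [mul_one] at h1
    linear_combination -h1
  let χ : G →ₜ* Multiplicative (ZMod m) :=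
    { toFun := fun g => .ofAdd (b g - a (QuotientGroup.mk g))
      map_one' := congrArg Multiplicative.ofAdd hone
      map_mul' := fun g h => congrArg Multiplicative.ofAdd (hmul g h)
      continuous_toFun := continuous_ofAdd.comp
        (b.continuous.sub (a.continuous.comp continuous_quotient_mk')) }
  have hχ : b n - a (QuotientGroup.mk n) = 0 := Multiplicative.ofAdd.injective (hN χ n hn)
  rw [(QuotientGroup.eq_one_iff n).2 hn] at hχ
  rw [QuotientGroup.mk_one] at hone
  linear_combination hχ - hone

theorem inflation_mem_transgressionRel {N₁ N₂ : Subgroup G} [N₁.Normal] [N₂.Normal]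
    (h : N₁ ≤ N₂) {q : H2 m (G ⧸ N₂) × C(G, ZMod m)} (hq : q ∈ transgressionRel m N₂) :
    (inflation m h q.1, q.2) ∈ transgressionRel m N₁ := by
  obtain ⟨f, hf, hd⟩ := hq
  exact ⟨cocyclePullback m (quotientProj h) f, by rw [← hf]; rfl, hd⟩

/-- The pullback of the classifying element along a homomorphism `G/N → Ū` that lifts to
`ρ : G → U` is the transgression of the restriction of `ρ` to `N`, up to sign. -/
theorem exists_mem_transgressionRel [NeZero m] (ω : ProfiniteCentralExtension m)
    (ρ' : (G ⧸ N) →ₜ* ω.Ubar) (ρ : G →ₜ* ω.U)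
    (hρ : ∀ g : G, ω.proj (ρ g) = ρ' (QuotientGroup.mk g)) :
    ∃ b : C(G, ZMod m), (pullback m ρ' ω.classifying, b) ∈ transgressionRel m N ∧
      ∀ n ∈ N, b n = b 1 ↔ ρ n = 1 := by
  -- The cochain measures how the section differs from the homomorphic lift `ρ`; on `N` the section
  -- contributes only the constant `ω.sec 1`.
  have hex : ∀ g : G, ∃ z, ω.ext.inl z = ω.sec (ρ' (QuotientGroup.mk g)) * (ρ g)⁻¹ := by
    intro g
    rw [← ω.proj_eq_one_iff, map_mul, map_inv, hρ, ω.proj_sec, mul_inv_cancel]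
  choose b hb using hex
  have hcl : Topology.IsClosedEmbedding fun z : ZMod m => ω.ext.inl (.ofAdd z) :=
    (continuous_of_discreteTopology).isClosedEmbedding
      (ω.ext.inl_injective.comp Multiplicative.ofAdd.injective)
  have hcont : Continuous fun g => (b g).toAdd := by
    rw [hcl.isInducing.continuous_iff]
    have h1 : ((fun z : ZMod m => ω.ext.inl (.ofAdd z)) ∘ fun g => (b g).toAdd) =
        fun g => ω.sec (ρ' (QuotientGroup.mk g)) * (ρ g)⁻¹ := funext hb
    rw [h1]
    exact ((ω.sec.continuous.comp ρ'.continuous_toFun).comp continuous_quotient_mk').mul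
      ρ.continuous_toFun.inv
  refine ⟨⟨fun g => (b g).toAdd, hcont⟩, ⟨cocyclePullback m ρ' ω.cocycle, rfl, ?_⟩, ?_⟩
  · intro g h
    change (b h).toAdd - (b (g * h)).toAdd + (b g).toAdd =
      ω.factor (ρ' (QuotientGroup.mk g)) (ρ' (QuotientGroup.mk h))
    have key : b g * b h = .ofAdd (ω.factor (ρ' (QuotientGroup.mk g)) (ρ' (QuotientGroup.mk h)))
        * b (g * h) := by
      apply ω.ext.inl_injective
      -- Centrality moves `b h` past `(ρ g)⁻¹`, which brings the inverses together as `(ρ (g *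
      -- h))⁻¹`.
      have hc := Subgroup.mem_center_iff.1 (ω.central ⟨b h, rfl⟩)
      rw [map_mul, map_mul, ω.inl_factor, hb (g * h), hb g, mul_assoc, hc, hb h]
      rw [QuotientGroup.mk_mul, map_mul ρ', map_mul ρ]
      group
    have key' := congrArg Multiplicative.toAdd key
    rw [toAdd_mul, toAdd_mul, toAdd_ofAdd] at key'
    linear_combination key'
  · intro n hn
    change (b n).toAdd = (b 1).toAdd ↔ ρ n = 1
    rw [Multiplicative.toAdd.injective.eq_iff, ← ω.ext.inl_injective.eq_iff, hb, hb,
      (QuotientGroup.eq_one_iff n).2 hn, QuotientGroup.mk_one, map_one ρ, mul_right_inj,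
      inv_inj]

end Transgression

/-! ### The liftable part: surjectivity, and injectivity from (c). -/

section Liftable

variable {m : ℕ} {Ω : Set (ProfiniteCentralExtension m)} {G : Type*} [Group G]
  [TopologicalSpace G]

theorem map_eq_one_of_mem_T {ω : ProfiniteCentralExtension m} (hω : ω ∈ Ω) (ρ : G →ₜ* ω.U)
    {g : G} (hg : g ∈ T Ω G) : ρ g = 1 :=
  (Subgroup.mem_iInf.1 (Subgroup.mem_iInf.1 (Subgroup.mem_iInf.1 hg ω) hω) ρ :)

theorem map_eq_one_of_mem_Tbar {ω : ProfiniteCentralExtension m} (hω : ω ∈ Ω)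
    (ρ : G →ₜ* ω.Ubar) {g : G} (hg : g ∈ Tbar Ω G) : ρ g = 1 :=
  (Subgroup.mem_iInf.1 (Subgroup.mem_iInf.1 (Subgroup.mem_iInf.1 hg ω) hω) ρ :)

theorem mem_T_iff {g : G} : g ∈ T Ω G ↔ ∀ ω ∈ Ω, ∀ ρ : G →ₜ* ω.U, ρ g = 1 :=
  ⟨fun hg _ hω ρ => map_eq_one_of_mem_T hω ρ hg, fun h => Subgroup.mem_iInf.2 fun ω =>
    Subgroup.mem_iInf.2 fun hω => Subgroup.mem_iInf.2 fun ρ => h ω hω ρ⟩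

theorem hom_zmod_eq_one_of_mem_Tbar {ω : ProfiniteCentralExtension m} (hω : ω ∈ Ω)
    (hj : ω.KernelEmbeds) (χ : G →ₜ* Multiplicative (ZMod m)) {g : G} (hg : g ∈ Tbar Ω G) :
    χ g = 1 := by
  obtain ⟨j, hj⟩ := hj
  let jc : Multiplicative (ZMod m) →ₜ* ω.Ubar := ⟨j, continuous_of_discreteTopology⟩
  exact (injective_iff_map_eq_one j).1 hj _ (map_eq_one_of_mem_Tbar hω (jc.comp χ) hg)

/-- The homomorphism `G/N → Ū` induced by a continuous homomorphism `G → U`, for `N ≤ T̄(G)`. -/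
def inducedHom {N : Subgroup G} [N.Normal] (hN : N ≤ Tbar Ω G)
    {ω : ProfiniteCentralExtension m} (hω : ω ∈ Ω) (ρ : G →ₜ* ω.U) : (G ⧸ N) →ₜ* ω.Ubar where
  toMonoidHom := QuotientGroup.lift N (ω.proj.comp ρ).toMonoidHom
    fun _ hn => map_eq_one_of_mem_Tbar hω (ω.proj.comp ρ) (hN hn)
  continuous_toFun := continuous_quot_lift _ (ω.proj.comp ρ).continuous_toFun

variable [IsTopologicalGroup G]

/-- Generators come from some `ρ`, which kills `T(G)`; the property passes to sums and negatives
because the relation is a subgroup. -/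
theorem exists_mem_transgressionRel_of_mem_liftablePart [NeZero m] {N : Subgroup G} [N.Normal]
    {x : H2 m (G ⧸ N)} (hx : x ∈ liftablePart Ω N) :
    ∃ b : C(G, ZMod m), (x, b) ∈ transgressionRel m N ∧ ∀ n ∈ N, n ∈ T Ω G → b n = b 1 := by
  induction hx using AddSubgroup.closure_induction with
  | mem x hx =>
    obtain ⟨ω, hω, ρ', ⟨ρ, hρ⟩, rfl⟩ := hx
    obtain ⟨b, hb, hbn⟩ := exists_mem_transgressionRel ω ρ' ρ hρ
    exact ⟨b, hb, fun n hn hT => (hbn n hn).2 (map_eq_one_of_mem_T hω ρ hT)⟩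
  | zero => exact ⟨0, zero_mem _, fun _ _ _ => rfl⟩
  | add x y _ _ hx hy =>
    obtain ⟨b, hb, hbn⟩ := hx
    obtain ⟨c, hc, hcn⟩ := hy
    exact ⟨b + c, add_mem hb hc, fun n hn hT => congrArg₂ (· + ·) (hbn n hn hT) (hcn n hn hT)⟩
  | neg x _ hx =>
    obtain ⟨b, hb, hbn⟩ := hx
    exact ⟨-b, neg_mem hb, fun n hn hT => congrArg Neg.neg (hbn n hn hT)⟩

/-- A lift `ρ` of a generator for `N₁` already induces a homomorphism on `G/N₂`, whose pullback
class inflates to that generator. -/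
theorem liftableInflation_surjective [NeZero m] {N₁ N₂ : Subgroup G} [N₁.Normal] [N₂.Normal]
    (h : N₁ ≤ N₂) (hN₂ : N₂ ≤ Tbar Ω G) : Function.Surjective (liftableInflation Ω h) := by
  have hle : liftablePart Ω N₁ ≤ (liftablePart Ω N₂).map (inflation m h) := by
    refine (AddSubgroup.closure_le _).2 ?_
    rintro _ ⟨ω, hω, ρ', ⟨ρ, hρ⟩, rfl⟩
    refine ⟨pullback m (inducedHom hN₂ hω ρ) ω.classifying,
      AddSubgroup.subset_closure ⟨ω, hω, _, ⟨ρ, fun _ => rfl⟩, rfl⟩, ?_⟩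
    have hcomp : (inducedHom hN₂ hω ρ).comp (quotientProj h) = ρ' := by
      ext x
      induction x using QuotientGroup.induction_on with
      | H g => exact hρ g
    rw [← hcomp, pullback_comp]
    rfl
  rintro ⟨x, hx⟩
  obtain ⟨y, hy, rfl⟩ := hle hx
  exact ⟨⟨y, hy⟩, rfl⟩

theorem liftableInflation_injective_of_le_sup [NeZero m] {N₁ N₂ : Subgroup G} [N₁.Normal]
    [N₂.Normal] (h : N₁ ≤ N₂)
    (hχ : ∀ χ : G →ₜ* Multiplicative (ZMod m), ∀ n ∈ N₁, χ n = 1) (hle : N₂ ≤ N₁ ⊔ T Ω G) :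
    Function.Injective (liftableInflation Ω h) := by
  refine (injective_iff_map_eq_zero _).2 ?_
  rintro ⟨x, hx⟩ hx0
  have hx0' : inflation m h x = 0 := congrArg Subtype.val hx0
  obtain ⟨b, hb, hbT⟩ := exists_mem_transgressionRel_of_mem_liftablePart hx
  have hb1 := inflation_mem_transgressionRel h hb
  simp only [hx0'] at hb1
  refine Subtype.ext (eq_zero_of_mem_transgressionRel hb fun y hy => ?_)
  -- `b - b 1` vanishes at `n` because the inflated class is zero, and at `t` because `t ∈ T(G)`.
  obtain ⟨n, hn, t, ht, rfl⟩ := Subgroup.mem_sup_of_normal_left.1 (hle hy)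
  have htN : t ∈ N₂ := (Subgroup.mul_mem_cancel_left _ (h hn)).1 hy
  have hmul := transgressionRel_apply_mul hb n htN
  have hn1 := eq_of_zero_mem_transgressionRel hχ hb1 hn
  have ht1 := hbT t htN ht
  simp only at hmul ⊢
  linear_combination hmul + hn1 + ht1

end Liftable

/-! ### From injectivity to (c): linear duality and compactness. -/

section Duality

variable {p : ℕ} [Fact p.Prime] {Ω : Set (ProfiniteCentralExtension p)} {G : Type*} [Group G]
  [TopologicalSpace G] [IsTopologicalGroup G]

/-- If inflation is injective on the liftable part, then finitely many of the homomorphisms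
`N₂ → ℤ/p` whose transgression is in the liftable part do not separate `N₂` from `N₁`. -/
theorem exists_eq_of_liftableInflation_injective {N₁ N₂ : Subgroup G} [N₁.Normal] [N₂.Normal]
    (h : N₁ ≤ N₂) (hχ : ∀ χ : G →ₜ* Multiplicative (ZMod p), ∀ n ∈ N₂, χ n = 1)
    (hinj : Function.Injective (liftableInflation Ω h)) {ι : Type*} [Fintype ι]
    (q : ι → H2 p (G ⧸ N₂) × C(G, ZMod p)) (hq : ∀ i, q i ∈ transgressionRel p N₂)
    (hqL : ∀ i, (q i).1 ∈ liftablePart Ω N₂) {y : G} (hy : y ∈ N₂) :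
    ∃ n ∈ N₁, ∀ i, (q i).2 n = (q i).2 y := by
  classical
  let θ (g : G) : ι → ZMod p := fun i => (q i).2 g - (q i).2 1
  let W : AddSubgroup (ι → ZMod p) :=
    { carrier := {v | ∃ n ∈ N₁, θ n = v}
      zero_mem' := ⟨1, one_mem _, funext fun i => sub_self _⟩
      add_mem' := by
        rintro _ _ ⟨n, hn, rfl⟩ ⟨n', hn', rfl⟩
        exact ⟨n * n', mul_mem hn hn',
          funext fun i => transgressionRel_apply_mul (hq i) n (h hn')⟩
      neg_mem' := by
        rintro _ ⟨n, hn, rfl⟩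
        exact ⟨n⁻¹, inv_mem hn, funext fun i => transgressionRel_apply_inv (hq i) (h hn)⟩ }
  suffices hyW : θ y ∈ W by
    obtain ⟨n, hn, hθ⟩ := hyW
    exact ⟨n, hn, fun i => sub_left_injective (congrFun hθ i)⟩
  by_contra hyW
  -- A functional killing `θ(N₁)` but not `θ y` gives a combination `r` of the `q i` whose class
  -- inflates to zero. Injectivity makes that class zero, so `r.2` is constant on `N₂`,
  -- contradicting `φ (θ y) ≠ 0`.
  obtain ⟨φ, hφy, hφW⟩ := Submodule.exists_le_ker_of_notMem
    (p := AddSubgroup.toZModSubmodule p W) (v := θ y) hyW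
  let c (i : ι) : ZMod p := φ (Pi.single i 1)
  have hφ : ∀ v, φ v = ∑ i, c i * v i := by
    intro v
    conv_lhs => rw [← Finset.univ_sum_single v, map_sum]
    refine Finset.sum_congr rfl fun i _ => ?_
    have h1 : Pi.single i (v i) = v i • (Pi.single i 1 : ι → ZMod p) := by
      rw [← Pi.single_smul, smul_eq_mul, mul_one]
    rw [h1, map_smul, smul_eq_mul, mul_comm]
  -- Natural-number representatives of the `c i` keep `r` in the additive subgroups.
  let r : H2 p (G ⧸ N₂) × C(G, ZMod p) := ∑ i, (c i).val • q i
  have hr : r ∈ transgressionRel p N₂ := sum_mem fun i _ => nsmul_mem (hq i) _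
  have hrL : r.1 ∈ liftablePart Ω N₂ := by
    rw [Prod.fst_sum]
    exact sum_mem fun i _ => nsmul_mem (hqL i) _
  have hr2 : ∀ g, r.2 g - r.2 1 = φ (θ g) := by
    intro g
    have hr3 : ∀ g, r.2 g = ∑ i, c i * (q i).2 g := by
      intro g
      rw [Prod.snd_sum, ContinuousMap.sum_apply]
      refine Finset.sum_congr rfl fun i _ => ?_
      rw [Prod.smul_snd, ContinuousMap.smul_apply, nsmul_eq_mul, ZMod.natCast_zmod_val]
    rw [hφ, hr3, hr3, ← Finset.sum_sub_distrib]
    exact Finset.sum_congr rfl fun i _ => (mul_sub _ _ _).symm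
  have hinf : inflation p h r.1 = 0 :=
    eq_zero_of_mem_transgressionRel (inflation_mem_transgressionRel h hr) fun n hn =>
      sub_eq_zero.1 ((hr2 n).trans (hφW (x := θ n) ⟨n, hn, rfl⟩))
  have hr0 : r.1 = 0 := congrArg Subtype.val
    ((injective_iff_map_eq_zero _).1 hinj ⟨r.1, hrL⟩ (Subtype.ext hinf))
  have hr' : ((0 : H2 p (G ⧸ N₂)), r.2) ∈ transgressionRel p N₂ := by
    rw [← hr0]
    exact hr
  exact hφy ((hr2 y).symm.trans (sub_eq_zero.2 (eq_of_zero_mem_transgressionRel hχ hr' hy)))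

theorem le_sup_of_liftableInflation_injective [CompactSpace G] {N₁ N₂ : Subgroup G} [N₁.Normal]
    [N₂.Normal] (h : N₁ ≤ N₂) (hN₁ : IsClosed (N₁ : Set G)) (hN₂ : N₂ ≤ Tbar Ω G)
    (hχ : ∀ χ : G →ₜ* Multiplicative (ZMod p), ∀ n ∈ N₂, χ n = 1)
    (hinj : Function.Injective (liftableInflation Ω h)) : N₂ ≤ N₁ ⊔ T Ω G := by
  intro y hy
  let J := {q : H2 p (G ⧸ N₂) × C(G, ZMod p) //
    q ∈ transgressionRel p N₂ ∧ q.1 ∈ liftablePart Ω N₂}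
  -- Finite intersection property in `N₁`, with one closed condition for each pair in `J`.
  obtain ⟨n, hn, hny⟩ := hN₁.isCompact.inter_iInter_nonempty
    (fun j : J => {g | j.1.2 g = j.1.2 y})
    (fun j => isClosed_eq j.1.2.continuous continuous_const) (fun F => by
      obtain ⟨n, hn, hny⟩ := exists_eq_of_liftableInflation_injective h hχ hinj
        (fun j : F => j.1.1) (fun j => j.1.2.1) (fun j => j.1.2.2) hy
      exact ⟨n, hn, Set.mem_iInter₂.2 fun j hj => hny ⟨j, hj⟩⟩)
  rw [Set.mem_iInter] at hny
  have hT : n⁻¹ * y ∈ T Ω G := by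
    refine mem_T_iff.2 fun ω hω ρ => ?_
    have hn' : n⁻¹ ∈ N₂ := inv_mem (h hn)
    obtain ⟨b, hb, hbn⟩ := exists_mem_transgressionRel ω (inducedHom hN₂ hω ρ) ρ fun _ => rfl
    have hbL : pullback p (inducedHom hN₂ hω ρ) ω.classifying ∈ liftablePart Ω N₂ :=
      AddSubgroup.subset_closure ⟨ω, hω, _, ⟨ρ, fun _ => rfl⟩, rfl⟩
    have h1 : b n = b y := hny ⟨(_, b), hb, hbL⟩
    have h2 := transgressionRel_apply_mul hb n⁻¹ hy
    have h3 := transgressionRel_apply_inv hb (h hn)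
    refine (hbn _ (mul_mem hn' hy)).1 ?_
    simp only at h2 h3
    linear_combination h2 + h3 - h1
  rw [← mul_inv_cancel_left n y]
  exact Subgroup.mul_mem_sup hn hT

end Duality

end ProfiniteCohomology

theorem corollary7p3 (p : ℕ) [Fact p.Prime]
    (Ω : Set (ProfiniteCentralExtension p)) (hΩ : Ω.Nonempty)
    (hI : ∀ ω ∈ Ω, ω.SeparatedByHoms) (hII : ∀ ω ∈ Ω, ω.KernelEmbeds)
    {G : Type*} [Group G] [TopologicalSpace G] [IsTopologicalGroup G]
    [CompactSpace G] [TotallyDisconnectedSpace G]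
    (N₁ N₂ : Subgroup G) [N₁.Normal] [N₂.Normal]
    (hN₁ : IsClosed (N₁ : Set G)) (hN₂ : IsClosed (N₂ : Set G))
    (h₁₂ : N₁ ≤ N₂) (hN₂T : N₂ ≤ ProfiniteCohomology.Tbar Ω G) :
    List.TFAE [
      Function.Bijective (ProfiniteCohomology.liftableInflation Ω h₁₂),
      Function.Injective (ProfiniteCohomology.liftableInflation Ω h₁₂),
      N₁ ⊔ ProfiniteCohomology.T Ω G = N₂ ⊔ ProfiniteCohomology.T Ω G] := by
  obtain ⟨ω, hω⟩ := hΩ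
  have hχ : ∀ χ : G →ₜ* Multiplicative (ZMod p), ∀ n ∈ N₂, χ n = 1 := fun χ n hn =>
    ProfiniteCohomology.hom_zmod_eq_one_of_mem_Tbar hω (hII ω hω) χ (hN₂T hn)
  tfae_have 1 → 2 := And.left
  tfae_have 2 → 1 := fun h =>
    ⟨h, ProfiniteCohomology.liftableInflation_surjective h₁₂ hN₂T⟩
  tfae_have 2 → 3 := fun h => le_antisymm (sup_le_sup_right h₁₂ _)
    (sup_le (ProfiniteCohomology.le_sup_of_liftableInflation_injective h₁₂ hN₁ hN₂T hχ h)
      le_sup_right)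
  tfae_have 3 → 2 := fun h => ProfiniteCohomology.liftableInflation_injective_of_le_sup h₁₂
    (fun χ n hn => hχ χ n (h₁₂ hn)) (h ▸ le_sup_left)
  tfae_finish
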